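/- Let $\mathbb{F}$ be a field of characteristic $0$ and let $K$ be a finite group. For a finite group $G$, let $\mathbb{F}B(G)=\mathbb{F}\otimes_{\mathbb{Z}}B(G)$, where $B(G)$ is the Grothendieck group of finite $G$-sets under disjoint union. A finite $(H,G)$-biset $V$ induces the $\mathbb{F}$-linear map $\mathbb{F}B(V):\mathbb{F}B(G)\to\mathbb{F}B(H)$, $[X]\mapsto[V\times_GX]$, and the cartesian product of sets induces bilinear products $\mathbb{F}B(G)\times\mathbb{F}B(H)\to\mathbb{F}B(G\times H)$, $(\alpha,\beta)\mapsto\alpha\times\beta$. The shifted Burnside functor $\mathbb{F}B_K$ is the Green biset functor with $\mathbb{F}B_K(G)=\mathbb{F}B(G\times K)$, with $\mathbb{F}B_K(U)=\mathbb{F}B(U\times K)$ for a finite $(H,G)$-biset $U$ (where $K$ acts on both sides of $U\times K$ by multiplication on the second component), and with products $\mathbb{F}B_K(G)\times\mathbb{F}B_K(H)\to\mathbb{F}B_K(G\times H)$ sending $(\alpha,\beta)$ to the image of $\alpha\times\beta$ under restriction along the homomorphism $G\times H\times K\to G\times K\times H\times K$, $(g,h,k)\mapsto(g,k,h,k)$.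 An ideal $I$ of $\mathbb{F}B_K$ is an $\mathbb{F}B_K$-submodule of $\mathbb{F}B_K$: a family of subspaces $I(G)\subseteq\mathbb{F}B_K(G)$, for all finite groups $G$, stable under the maps $\mathbb{F}B_K(U)$ for all finite bisets $U$, and such that the product of an element of $\mathbb{F}B_K(G)$ and an element of $I(H)$ is in $I(G\times H)$, for all finite groups $G$ and $H$. The ideal generated by an element of $\mathbb{F}B_K(G)$ is the intersection of all ideals $I$ such that $I(G)$ contains this element. For a subgroup $L$ of $G\times K$, let $$e_L^{G\times K}=\frac{1}{|N_{G\times K}(L)|}\sum_{X\leq L}|X|\,\mu(X,L)\,[(G\times K)/X]\in\mathbb{F}B_K(G)$$ be the corresponding primitive idempotent, where $\mu$ is the Möbius function of the poset of subgroups of $G\times K$. For a finite group $L$ and a group homomorphism $\varphi:L\to K$, let $L_\varphi=\{(l,\varphi(l))\mid l\in L\}\leq L\times K$, and let $\mathsf{e}_{L,\varphi}$ be the ideal of $\mathbb{F}B_K$ generated by $e_{L_\varphi}^{L\times K}\in\mathbb{F}B_K(L)$. \textbf{Theorem.} Let $G$ be a finite group, let $L$ be a subgroup of $G\times K$, and let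 $p_2:L\to K$ be the restriction to $L$ of the second projection $G\times K\to K$. \begin{enumerate} \item For every ideal $I$ of $\mathbb{F}B_K$, the idempotent $e_L^{G\times K}$ belongs to $I(G)$ if and only if the idempotent $e_{L_{p_2}}^{L\times K}$ belongs to $I(L)$. \item The ideal of $\mathbb{F}B_K$ generated by $e_L^{G\times K}$ is equal to $\mathsf{e}_{L,p_2}$, that is, to the ideal generated by $e_{L_{p_2}}^{L\times K}$. \end{enumerate} -/

import Mathlib

open scoped TensorProduct

universe u v

namespace BurnsideShift

/-! ### Finite `G`-sets and the Burnside group -/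

/-- A finite (left) `G`-set. -/
structure FinGSet (G : Type u) [Group G] where
  carrier : Type u
  [finite : Finite carrier]
  [action : MulAction G carrier]

attribute [instance] FinGSet.finite FinGSet.action

/-- Isomorphism of `G`-sets. -/
def FinGSet.IsIso {G : Type u} [Group G] (X Y : FinGSet G) : Prop :=
  ∃ e : X.carrier ≃ Y.carrier, ∀ (g : G) (x : X.carrier), e (g • x) = g • e x

instance FinGSet.setoid (G : Type u) [Group G] : Setoid (FinGSet G) where
  r := FinGSet.IsIso
  iseqv :=
    { refl := fun _ => ⟨Equiv.refl _, fun _ _ => rfl⟩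
      symm := by
        rintro X Y ⟨e, he⟩
        refine ⟨e.symm, fun g y => ?_⟩
        rw [Equiv.symm_apply_eq, he, Equiv.apply_symm_apply]
      trans := by
        rintro X Y Z ⟨e, he⟩ ⟨f, hf⟩
        exact ⟨e.trans f, fun g x => by simp [he, hf]⟩ }

/-- The isomorphism classes of finite `G`-sets. -/
def GSetClass (G : Type u) [Group G] : Type (u + 1) := Quotient (FinGSet.setoid G)

/-- The isomorphism class of a finite `G`-set. -/
def FinGSet.cls {G : Type u} [Group G] (X : FinGSet G) : GSetClass G :=
  Quotient.mk (FinGSet.setoid G) X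

/-- The disjoint union of two `G`-sets. -/
def FinGSet.disjUnion {G : Type u} [Group G] (X Y : FinGSet G) : FinGSet G where
  carrier := X.carrier ⊕ Y.carrier

/-- The empty `G`-set. -/
def FinGSet.empty (G : Type u) [Group G] : FinGSet G where
  carrier := PEmpty.{u + 1}
  action :=
    { smul := fun _ x => x
      one_smul := fun x => x.elim
      mul_smul := fun _ _ x => x.elim }

instance GSetClass.add (G : Type u) [Group G] : Add (GSetClass G) where
  add := Quotient.map₂ FinGSet.disjUnion (by
    rintro X X' ⟨e, he⟩ Y Y' ⟨f, hf⟩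
    refine ⟨Equiv.sumCongr e f, ?_⟩
    rintro g (x | y)
    · exact congrArg Sum.inl (he g x)
    · exact congrArg Sum.inr (hf g y))

instance GSetClass.zero (G : Type u) [Group G] : Zero (GSetClass G) where
  zero := (FinGSet.empty G).cls

/-- Disjoint union makes the isomorphism classes of finite `G`-sets a commutative monoid. -/
instance GSetClass.addCommMonoid (G : Type u) [Group G] : AddCommMonoid (GSetClass G) where
  nsmul := nsmulRec
  add_assoc := by
    rintro ⟨X⟩ ⟨Y⟩ ⟨Z⟩
    refine Quotient.sound ⟨Equiv.sumAssoc _ _ _, ?_⟩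
    rintro g ((x | y) | z) <;> rfl
  zero_add := by
    rintro ⟨X⟩
    refine Quotient.sound ⟨Equiv.emptySum PEmpty.{u + 1} X.carrier, ?_⟩
    rintro g (x | x)
    · exact x.elim
    · rfl
  add_zero := by
    rintro ⟨X⟩
    refine Quotient.sound ⟨Equiv.sumEmpty X.carrier PEmpty.{u + 1}, ?_⟩
    rintro g (x | x)
    · rfl
    · exact x.elim
  add_comm := by
    rintro ⟨X⟩ ⟨Y⟩
    refine Quotient.sound ⟨Equiv.sumComm _ _, ?_⟩
    rintro g (x | y) <;> rfl

/-- The Burnside group `B(G)`: the Grothendieck group of finite `G`-sets. -/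
abbrev Burnside (G : Type u) [Group G] : Type (u + 1) :=
  Algebra.GrothendieckAddGroup (GSetClass G)

/-- `𝔽B(G) = 𝔽 ⊗_ℤ B(G)`. -/
abbrev FBurnside (𝔽 : Type v) [Field 𝔽] (G : Type u) [Group G] : Type (max v (u + 1)) :=
  𝔽 ⊗[ℤ] Burnside G

/-- The element `[X]` of `𝔽B(G)` given by a finite `G`-set `X`. -/
noncomputable def ofGSet (𝔽 : Type v) [Field 𝔽] {G : Type u} [Group G] (X : FinGSet G) :
    FBurnside 𝔽 G :=
  (1 : 𝔽) ⊗ₜ[ℤ] Algebra.GrothendieckAddGroup.of X.cls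

/-- The `𝔽`-linear map `𝔽B(G) → 𝔽B(H)` extending an additive map on isomorphism classes. -/
noncomputable def extendAdd (𝔽 : Type v) [Field 𝔽] {G H : Type u} [Group G] [Group H]
    (f : GSetClass G →+ GSetClass H) : FBurnside 𝔽 G →ₗ[𝔽] FBurnside 𝔽 H :=
  (Algebra.GrothendieckAddGroup.lift
    (Algebra.GrothendieckAddGroup.of.comp f)).toIntLinearMap.baseChange 𝔽

/-! ### Bisets and their action on Burnside groups -/

/-- A finite `(H,G)`-biset: a finite set with commuting left `H`-action and right `G`-action. -/
structure FinBiset (H G : Type u) [Group H] [Group G] where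
  carrier : Type u
  [finite : Finite carrier]
  [left : MulAction H carrier]
  [right : MulAction Gᵐᵒᵖ carrier]
  [comm : SMulCommClass H Gᵐᵒᵖ carrier]

attribute [instance] FinBiset.finite FinBiset.left FinBiset.right FinBiset.comm

open MulOpposite in
/-- The orbit relation on `V × X` of the right `G`-action `(v,x)·g = (v·g, g⁻¹x)`. -/
def tensorSetoid {H G : Type u} [Group H] [Group G] (V : FinBiset H G) (X : FinGSet G) :
    Setoid (V.carrier × X.carrier) where
  r p q := ∃ g : G, q = (op g • p.1, g⁻¹ • p.2)
  iseqv :=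
    { refl := fun p => ⟨1, by simp⟩
      symm := by
        rintro ⟨v, x⟩ q ⟨g, rfl⟩
        refine ⟨g⁻¹, ?_⟩
        simp [smul_smul]
      trans := by
        rintro ⟨v, x⟩ q r ⟨g, rfl⟩ ⟨h, rfl⟩
        refine ⟨g * h, ?_⟩
        simp [smul_smul] }

/-- The `H`-set `V ×_G X = (V × X)/G`, for an `(H,G)`-biset `V` and a `G`-set `X`. -/
def FinBiset.tensor {H G : Type u} [Group H] [Group G] (V : FinBiset H G) (X : FinGSet G) :
    FinGSet H where
  carrier := Quotient (tensorSetoid V X)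
  finite := inferInstance
  action :=
    { smul := fun h => Quotient.map (fun p => (h • p.1, p.2)) (by
        rintro ⟨v, x⟩ q ⟨g, rfl⟩
        exact ⟨g, by simp [smul_comm h]⟩)
      one_smul := by
        rintro ⟨v, x⟩
        exact congrArg (Quotient.mk (tensorSetoid V X)) (Prod.ext (one_smul H v) rfl)
      mul_smul := by
        rintro h h' ⟨v, x⟩
        exact congrArg (Quotient.mk (tensorSetoid V X)) (Prod.ext (mul_smul h h' v) rfl) }

/-- `X ↦ V ×_G X` as an additive map on isomorphism classes. -/
def FinBiset.tensorHom {H G : Type u} [Group H] [Group G] (V : FinBiset H G) :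
    GSetClass G →+ GSetClass H where
  toFun := Quotient.map V.tensor (by
    rintro X Y ⟨e, he⟩
    refine ⟨Quotient.congr (Equiv.prodCongr (Equiv.refl _) e) ?_, ?_⟩
    · rintro ⟨v, x⟩ ⟨w, y⟩
      constructor
      · rintro ⟨g, hg⟩
        refine ⟨g, ?_⟩
        obtain ⟨rfl, rfl⟩ := Prod.mk.inj hg
        exact Prod.ext rfl (he _ _)
      · rintro ⟨g, hg⟩
        refine ⟨g, ?_⟩
        obtain ⟨h1, h2⟩ := Prod.mk.inj hg
        exact Prod.ext h1 (e.injective (h2.trans (he _ _).symm))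
    · rintro h ⟨v, x⟩
      rfl)
  map_zero' := by
    refine Quotient.sound ⟨⟨fun q => ?_, fun x => x.elim, ?_, ?_⟩, ?_⟩
    · exact Quotient.lift (fun p : V.carrier × PEmpty.{u + 1} => p.2) (fun p => p.2.elim) q
    · rintro ⟨v, x⟩
      exact x.elim
    · intro x
      exact x.elim
    · rintro h ⟨v, x⟩
      exact x.elim
  map_add' := by
    rintro ⟨X⟩ ⟨Y⟩
    refine Quotient.sound ⟨⟨?_, ?_, ?_, ?_⟩, ?_⟩
    · refine Quotient.lift (fun p : V.carrier × (X.carrier ⊕ Y.carrier) =>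
        (Sum.elim (fun x => Sum.inl (Quotient.mk (tensorSetoid V X) (p.1, x)))
          (fun y => Sum.inr (Quotient.mk (tensorSetoid V Y) (p.1, y))) p.2 :
          Quotient (tensorSetoid V X) ⊕ Quotient (tensorSetoid V Y))) ?_
      rintro ⟨v, x | y⟩ q ⟨g, rfl⟩
      · exact congrArg Sum.inl (Quotient.sound ⟨g, rfl⟩)
      · exact congrArg Sum.inr (Quotient.sound ⟨g, rfl⟩)
    · refine Sum.elim
        (Quotient.map (fun p => (p.1, Sum.inl p.2)) ?_)
        (Quotient.map (fun p => (p.1, Sum.inr p.2)) ?_)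
      · rintro ⟨v, x⟩ q ⟨g, rfl⟩
        exact ⟨g, rfl⟩
      · rintro ⟨v, x⟩ q ⟨g, rfl⟩
        exact ⟨g, rfl⟩
    · rintro ⟨v, x | y⟩ <;> rfl
    · rintro (⟨v, x⟩ | ⟨v, y⟩) <;> rfl
    · rintro h ⟨v, x | y⟩ <;> rfl

/-- The value `𝔽B(V) : 𝔽B(G) → 𝔽B(H)` of the Burnside functor at a finite `(H,G)`-biset. -/
noncomputable def burnsideMap (𝔽 : Type v) [Field 𝔽] {H G : Type u} [Group H] [Group G]
    (V : FinBiset H G) : FBurnside 𝔽 G →ₗ[𝔽] FBurnside 𝔽 H :=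
  extendAdd 𝔽 V.tensorHom

/-! ### The cartesian product -/

/-- The `(G × H)`-set `X × Y`, for a `G`-set `X` and an `H`-set `Y`. -/
def FinGSet.extProd {G H : Type u} [Group G] [Group H] (X : FinGSet G) (Y : FinGSet H) :
    FinGSet (G × H) where
  carrier := X.carrier × Y.carrier
  action :=
    { smul := fun a p => (a.1 • p.1, a.2 • p.2)
      one_smul := fun p => Prod.ext (one_smul G p.1) (one_smul H p.2)
      mul_smul := fun a b p => Prod.ext (mul_smul a.1 b.1 p.1) (mul_smul a.2 b.2 p.2) }

/-- The cartesian product on isomorphism classes, as a biadditive map. -/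
def extProdHom (G H : Type u) [Group G] [Group H] :
    GSetClass G →+ GSetClass H →+ GSetClass (G × H) where
  toFun a :=
    { toFun := fun b => Quotient.map₂ FinGSet.extProd (by
        rintro X X' ⟨e, he⟩ Y Y' ⟨f, hf⟩
        exact ⟨Equiv.prodCongr e f, fun a p => Prod.ext (he a.1 p.1) (hf a.2 p.2)⟩) a b
      map_zero' := by
        obtain ⟨X⟩ := a
        refine Quotient.sound ⟨Equiv.prodPEmpty X.carrier, ?_⟩
        rintro g ⟨x, y⟩
        exact y.elim
      map_add' := by
        obtain ⟨X⟩ := a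
        rintro ⟨Y⟩ ⟨Z⟩
        refine Quotient.sound ⟨Equiv.prodSumDistrib _ _ _, ?_⟩
        rintro g ⟨x, y | z⟩ <;> rfl }
  map_zero' := by
    ext b
    obtain ⟨Y⟩ := b
    refine Quotient.sound ⟨Equiv.pemptyProd Y.carrier, ?_⟩
    rintro g ⟨x, y⟩
    exact x.elim
  map_add' := by
    rintro ⟨X⟩ ⟨X'⟩
    ext b
    obtain ⟨Y⟩ := b
    refine Quotient.sound ⟨Equiv.sumProdDistrib _ _ _, ?_⟩
    rintro g ⟨x | x, y⟩ <;> rfl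

theorem lift_of {M : Type*} {A : Type*} [AddCommMonoid M] [AddCommGroup A] (f : M →+ A) (m : M) :
    Algebra.GrothendieckAddGroup.lift f (Algebra.GrothendieckAddGroup.of m) = f m :=
  DFunLike.congr_fun (Algebra.GrothendieckAddGroup.lift.symm_apply_apply f) m

theorem lift_add {M : Type*} {A : Type*} [AddCommMonoid M] [AddCommGroup A] (f g : M →+ A) :
    Algebra.GrothendieckAddGroup.lift (f + g) =
      Algebra.GrothendieckAddGroup.lift f + Algebra.GrothendieckAddGroup.lift g := by
  apply Algebra.GrothendieckAddGroup.lift.symm.injective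
  rw [Equiv.symm_apply_apply]
  refine AddMonoidHom.ext fun m => ?_
  exact (congrArg₂ (· + ·) (lift_of f m) (lift_of g m)).symm

/-- The biadditive extension of the cartesian product to Burnside groups. -/
noncomputable def burnsideProd (G H : Type u) [Group G] [Group H] :
    Burnside G →+ Burnside H →+ Burnside (G × H) :=
  Algebra.GrothendieckAddGroup.lift
    { toFun := fun a => Algebra.GrothendieckAddGroup.lift
        (Algebra.GrothendieckAddGroup.of.comp (extProdHom G H a))
      map_zero' := by
        rw [map_zero, AddMonoidHom.comp_zero]
        exact add_eq_left.mp ((lift_add 0 0).symm.trans (by rw [add_zero]))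
      map_add' := fun a b => by rw [map_add, AddMonoidHom.comp_add, lift_add] }

/-- The `𝔽`-bilinear product `𝔽B(G) × 𝔽B(H) → 𝔽B(G × H)`, `(α, β) ↦ α × β`, of the Green biset
functor `𝔽B`; on pure tensors it is `(a ⊗ x, b ⊗ y) ↦ ab ⊗ (x × y)`. -/
noncomputable def fburnsideProd (𝔽 : Type v) [Field 𝔽] {G H : Type u} [Group G] [Group H] :
    FBurnside 𝔽 G →ₗ[𝔽] FBurnside 𝔽 H →ₗ[𝔽] FBurnside 𝔽 (G × H) :=
  LinearMap.liftBaseChange 𝔽 (AddMonoidHom.toIntLinearMap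
    (AddMonoidHom.mk' (fun x => (burnsideProd G H x).toIntLinearMap.baseChange 𝔽) (fun x y => by
      rw [map_add, ← LinearMap.baseChange_add]
      rfl)))

/-! ### The Burnside functor shifted by `K` -/

/-- The left action `(h,k)·(u,x) = (hu, kx)` of `H × K` on `U × K`. -/
abbrev shiftLeft (K : Type u) [Group K] {H G : Type u} [Group H] [Group G]
    (U : FinBiset H G) : MulAction (H × K) (U.carrier × K) where
  smul a p := (a.1 • p.1, a.2 * p.2)
  one_smul p := Prod.ext (one_smul H p.1) (one_mul p.2)
  mul_smul a b p := Prod.ext (mul_smul a.1 b.1 p.1) (mul_assoc a.2 b.2 p.2)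

/-- The right action `(u,x)·(g,k) = (ug, xk)` of `G × K` on `U × K`. -/
abbrev shiftRight (K : Type u) [Group K] {H G : Type u} [Group H] [Group G]
    (U : FinBiset H G) : MulAction (G × K)ᵐᵒᵖ (U.carrier × K) where
  smul a p := (MulOpposite.op a.unop.1 • p.1, p.2 * a.unop.2)
  one_smul p := Prod.ext (one_smul Gᵐᵒᵖ p.1) (mul_one p.2)
  mul_smul a b p := Prod.ext
    (mul_smul (MulOpposite.op a.unop.1) (MulOpposite.op b.unop.1) p.1)
    (mul_assoc p.2 b.unop.2 a.unop.2).symm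

/-- The `(H × K, G × K)`-biset `U × K`, where `K` acts on both sides by multiplication on the
second component. -/
def FinBiset.shift (K : Type u) [Group K] [Finite K] {H G : Type u} [Group H] [Group G]
    (U : FinBiset H G) : FinBiset (H × K) (G × K) where
  carrier := U.carrier × K
  left := shiftLeft K U
  right := shiftRight K U
  comm :=
    letI := shiftLeft K U
    letI := shiftRight K U
    ⟨fun a b p => Prod.ext (smul_comm a.1 (MulOpposite.op b.unop.1) p.1)
      (mul_assoc a.2 p.2 b.unop.2).symm⟩

/-- `𝔽B_K(G) = 𝔽B(G × K)`. -/
abbrev FBK (𝔽 : Type v) [Field 𝔽] (K : Type u) [Group K] (G : Type u) [Group G] :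
    Type (max v (u + 1)) :=
  FBurnside 𝔽 (G × K)

/-- `𝔽B_K(U) = 𝔽B(U × K) : 𝔽B_K(G) → 𝔽B_K(H)`, for a finite `(H,G)`-biset `U`. -/
noncomputable def shiftedMap (𝔽 : Type v) [Field 𝔽] (K : Type u) [Group K] [Finite K]
    {H G : Type u} [Group H] [Group G] (U : FinBiset H G) : FBK 𝔽 K G →ₗ[𝔽] FBK 𝔽 K H :=
  burnsideMap 𝔽 (U.shift K)

/-- The `(Q,P)`-biset `P` attached to a homomorphism `f : Q → P`, with `q·x·p = f(q) x p`.
If `f` is injective with image `D` and `δ : D → Q` is the inverse isomorphism, it is the composite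
`Iso(δ) ∘ Res_D^P`. -/
def FinBiset.ofHom {Q P : Type u} [Group Q] [Group P] [Finite P] (f : Q →* P) :
    FinBiset Q P where
  carrier := P
  left := MulAction.compHom P f
  right := inferInstance
  comm :=
    letI := MulAction.compHom P f
    ⟨fun q p x => (mul_assoc (f q) x p.unop).symm⟩

/-- The homomorphism `(g,h,k) ↦ ((g,k),(h,k))`, whose image is the subgroup `Δ` of
`(G × K) × (H × K)`. -/
def shiftDiag (G H K : Type u) [Group G] [Group H] [Group K] :
    (G × H) × K →* (G × K) × (H × K) where
  toFun a := ((a.1.1, a.2), (a.1.2, a.2))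
  map_one' := rfl
  map_mul' _ _ := rfl

/-- The product `𝔽B_K(G) × 𝔽B_K(H) → 𝔽B_K(G × H)` of the shifted Green biset functor:
`α ×_K β = 𝔽B(Iso(δ) ∘ Res_Δ)(α × β)`. -/
noncomputable def shiftedProd (𝔽 : Type v) [Field 𝔽] (K : Type u) [Group K] [Finite K]
    {G H : Type u} [Group G] [Finite G] [Group H] [Finite H]
    (a : FBK 𝔽 K G) (b : FBK 𝔽 K H) : FBK 𝔽 K (G × H) :=
  burnsideMap 𝔽 (FinBiset.ofHom (shiftDiag G H K)) (fburnsideProd 𝔽 a b)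

/-- An ideal of the Green biset functor `𝔽B_K`: an `𝔽B_K`-submodule of `𝔽B_K`, that is a family of
subspaces `I(G) ⊆ 𝔽B_K(G)`, for all finite groups `G`, stable under the maps `𝔽B_K(U)` for all
finite bisets `U` and under left products with arbitrary elements of `𝔽B_K` (as `𝔽B_K` is
commutative, left, right and two-sided ideals are the same). -/
structure ShiftedIdeal (𝔽 : Type v) [Field 𝔽] (K : Type u) [Group K] [Finite K] where
  obj : ∀ (G : Type u) [Group G] [Finite G], Submodule 𝔽 (FBK 𝔽 K G)
  map_mem : ∀ {H G : Type u} [Group H] [Finite H] [Group G] [Finite G] (U : FinBiset H G)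
    (a : FBK 𝔽 K G), a ∈ obj G → shiftedMap 𝔽 K U a ∈ obj H
  prod_mem : ∀ {G H : Type u} [Group G] [Finite G] [Group H] [Finite H]
    (a : FBK 𝔽 K G) (b : FBK 𝔽 K H), b ∈ obj H → shiftedProd 𝔽 K a b ∈ obj (G × H)

/-- The ideal of `𝔽B_K` generated by `a ∈ 𝔽B_K(G)`: the intersection of all ideals `I` with
`a ∈ I(G)`. -/
def ShiftedIdeal.span (𝔽 : Type v) [Field 𝔽] (K : Type u) [Group K] [Finite K]
    (G : Type u) [Group G] [Finite G] (a : FBK 𝔽 K G) : ShiftedIdeal 𝔽 K where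
  obj H _ _ := ⨅ I : {I : ShiftedIdeal 𝔽 K // a ∈ I.obj G}, I.1.obj H
  map_mem U b hb := by
    simp only [Submodule.mem_iInf] at hb ⊢
    exact fun I => I.1.map_mem U b (hb I)
  prod_mem b c hc := by
    simp only [Submodule.mem_iInf] at hc ⊢
    exact fun I => I.1.prod_mem b c (hc I)

/-! ### The idempotents and the ideals they generate -/

/-- The Möbius function of the poset of subgroups of a finite group `G`. -/
noncomputable def subgroupMu {G : Type u} [Group G] [Finite G] (X L : Subgroup G) : ℤ :=
  letI : Fintype (Subgroup G) := Fintype.ofFinite _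
  letI : DecidableEq (Subgroup G) := Classical.decEq _
  letI : DecidableLE (Subgroup G) := Classical.decRel _
  letI : DecidableLT (Subgroup G) := Classical.decRel _
  letI : LocallyFiniteOrder (Subgroup G) := Fintype.toLocallyFiniteOrder
  IncidenceAlgebra.mu ℤ X L

/-- The transitive `G`-set `G/X`. -/
def FinGSet.quot {G : Type u} [Group G] [Finite G] (X : Subgroup G) : FinGSet G where
  carrier := G ⧸ X

/-- The primitive idempotent `e_L^G = |N_G(L)|⁻¹ ∑_{X ≤ L} |X| μ(X,L) [G/X]` of `𝔽B(G)`. -/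
noncomputable def idem (𝔽 : Type v) [Field 𝔽] {G : Type u} [Group G] [Finite G]
    (L : Subgroup G) : FBurnside 𝔽 G :=
  (Nat.card (Subgroup.normalizer (L : Set G)) : 𝔽)⁻¹ •
    ∑ᶠ X : {X : Subgroup G // X ≤ L},
      ((Nat.card X.1 : 𝔽) * (subgroupMu X.1 L : 𝔽)) • ofGSet 𝔽 (FinGSet.quot X.1)

/-- `e_{L,φ}`, for a finite group `(L,φ)` over `K`: the ideal of `𝔽B_K` generated by
`e_{L_φ}^{L × K} ∈ 𝔽B_K(L)`, where `L_φ = {(l, φ(l)) | l ∈ L}`. -/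
noncomputable def groupOverIdeal (𝔽 : Type v) [Field 𝔽] {K : Type u} [Group K] [Finite K]
    (L : Type u) [Group L] [Finite L] (φ : L →* K) : ShiftedIdeal 𝔽 K :=
  ShiftedIdeal.span 𝔽 K L (idem 𝔽 φ.graph)

/-- The restriction `p₂ : L → K` to `L ≤ G × K` of the second projection. -/
def sndProj {G K : Type u} [Group G] [Group K] (L : Subgroup (G × K)) : L →* K :=
  (MonoidHom.snd G K).comp L.subtype

end BurnsideShift

/-! Let `p₁ : L → G` be the first projection and `π = p₁ × id : L × K → G × K`. The graph `S` of
`p₂` consists of the pairs `((g,k), k)`, and `π` maps it bijectively onto `L`. Two operations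
available to every ideal then link the two idempotents.

Induction along `p₁` sends `[(L × K)/X]` to `[(G × K)/π(X)]`. As `π` is injective on `S`, it
preserves the orders and Möbius values of the subgroups of `S`, so `e_S` goes to a nonzero multiple
of `e_L` (`map_idem`).

Conversely, restrict `e_L` along `p₁` and multiply by `e_S`, using that a product followed by
restriction to the diagonal is the ordinary product of the Burnside algebra (`diagMul_ofGSet`).
Multiplying `e_S` by `[Z]` scales it by the number of `S`-fixed points of `Z` (`mul_idem`, resting
on Weisner's theorem). For `Z = (G × K)/X` with `X ≤ L` there are none unless `X = L`, so the result
is a nonzero multiple of `e_S` (`diagMul_idem_res_idem`).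

Thus the same ideals contain both elements, and the generated ideals coincide. -/

namespace BurnsideShift

/-! ### Classes of finite sets with group action, biset maps on them, and orbit counting. -/

section GSets

variable {P Q : Type u} [Group P] [Group Q]

/-- Restriction of a `P`-set along a homomorphism `Q → P`. -/
def FinGSet.res (f : Q →* P) (X : FinGSet P) : FinGSet Q where
  carrier := X.carrier
  action := MulAction.compHom X.carrier f

/-- The cartesian product of two `P`-sets, with the diagonal action. -/
def FinGSet.prod (X Y : FinGSet P) : FinGSet P where
  carrier := X.carrier × Y.carrier

/-- A stable subset of a `P`-set. -/
def FinGSet.sub (X : FinGSet P) (s : Set X.carrier) (hs : ∀ (g : P), ∀ x ∈ s, g • x ∈ s) :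
    FinGSet P where
  carrier := s
  action :=
    { smul := fun g x => ⟨g • x.1, hs g x.1 x.2⟩
      one_smul := fun x => Subtype.ext (one_smul P x.1)
      mul_smul := fun g h x => Subtype.ext (mul_smul g h x.1) }

variable (𝔽 : Type v) [Field 𝔽]

theorem ofGSet_eq_of_isIso {X Y : FinGSet P} (h : X.IsIso Y) : ofGSet 𝔽 X = ofGSet 𝔽 Y := by
  have : X.cls = Y.cls := Quotient.sound h
  simp only [ofGSet, this]

theorem ofGSet_disjUnion (X Y : FinGSet P) :
    ofGSet 𝔽 (X.disjUnion Y) = ofGSet 𝔽 X + ofGSet 𝔽 Y := by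
  have : (X.disjUnion Y).cls = X.cls + Y.cls := rfl
  simp only [ofGSet, this, map_add, TensorProduct.tmul_add]

theorem ofGSet_empty : ofGSet 𝔽 (FinGSet.empty P) = 0 := by
  have : (FinGSet.empty P).cls = 0 := rfl
  simp only [ofGSet, this, map_zero, TensorProduct.tmul_zero]

theorem ofGSet_eq_zero_of_isEmpty (X : FinGSet P) [IsEmpty X.carrier] : ofGSet 𝔽 X = 0 := by
  rw [← ofGSet_empty 𝔽 (P := P)]
  exact ofGSet_eq_of_isIso 𝔽
    ⟨Equiv.equivOfIsEmpty X.carrier PEmpty.{u + 1}, fun _ x => isEmptyElim x⟩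

theorem ofGSet_sub_add_compl (X : FinGSet P) (s : Set X.carrier)
    (hs : ∀ (g : P), ∀ x ∈ s, g • x ∈ s) (hs' : ∀ (g : P), ∀ x ∈ sᶜ, g • x ∈ sᶜ) :
    ofGSet 𝔽 X = ofGSet 𝔽 (X.sub s hs) + ofGSet 𝔽 (X.sub sᶜ hs') := by
  classical
  rw [← ofGSet_disjUnion]
  symm
  refine ofGSet_eq_of_isIso 𝔽 ⟨Equiv.Set.sumCompl s, ?_⟩
  rintro g (x | x) <;> rfl

theorem ofGSet_eq_quot_stabilizer [Finite P] (W : FinGSet P) (w : W.carrier)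
    (h : ∀ w', ∃ g : P, g • w = w') :
    ofGSet 𝔽 W = ofGSet 𝔽 (FinGSet.quot (MulAction.stabilizer P w)) := by
  symm
  refine ofGSet_eq_of_isIso 𝔽 ⟨Equiv.ofBijective (MulAction.ofQuotientStabilizer P w)
    ⟨MulAction.injective_ofQuotientStabilizer P w, fun w' => ?_⟩, fun g x => ?_⟩
  · obtain ⟨g, rfl⟩ := h w'
    exact ⟨(g : P ⧸ MulAction.stabilizer P w), rfl⟩
  · exact MulAction.ofQuotientStabilizer_smul P w g x

theorem burnsideMap_ofGSet (V : FinBiset Q P) (X : FinGSet P) :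
    burnsideMap 𝔽 V (ofGSet 𝔽 X) = ofGSet 𝔽 (V.tensor X) := by
  simp only [burnsideMap, extendAdd, ofGSet, LinearMap.baseChange_tmul]
  congr 1
  exact lift_of _ _

theorem fburnsideProd_ofGSet (X : FinGSet P) (Y : FinGSet Q) :
    fburnsideProd 𝔽 (ofGSet 𝔽 X) (ofGSet 𝔽 Y) = ofGSet 𝔽 (X.extProd Y) := by
  simp only [fburnsideProd, ofGSet, LinearMap.liftBaseChange_tmul, one_smul]
  change (1 : 𝔽) ⊗ₜ[ℤ] _ = _
  congr 1
  change (burnsideProd P Q (Algebra.GrothendieckAddGroup.of X.cls))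
    (Algebra.GrothendieckAddGroup.of Y.cls) = _
  rw [burnsideProd, lift_of]
  exact lift_of _ _

/-- A biset which is free and transitive for the right action restricts along a homomorphism. -/
theorem ofGSet_tensor_eq_res (V : FinBiset Q P) (f : Q →* P) (b : V.carrier)
    (hb : Function.Bijective fun p : P => MulOpposite.op p • b)
    (hf : ∀ q : Q, q • b = MulOpposite.op (f q) • b) (X : FinGSet P) :
    ofGSet 𝔽 (V.tensor X) = ofGSet 𝔽 (X.res f) := by
  symm
  refine ofGSet_eq_of_isIso 𝔽 ⟨Equiv.ofBijective
    (fun x : X.carrier => (Quotient.mk (tensorSetoid V X) (b, x))) ⟨?_, ?_⟩, ?_⟩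
  · intro (x : X.carrier) (y : X.carrier) h
    obtain ⟨g, hg⟩ := Quotient.exact h
    obtain ⟨h1, h2⟩ := Prod.mk.inj hg
    have : g = 1 := hb.1 (by simpa using h1.symm)
    subst this
    have h3 : y = (1 : P)⁻¹ • x := h2
    rw [h3, inv_one, one_smul]
  · rintro ⟨v, x⟩
    obtain ⟨p, rfl⟩ := hb.2 v
    exact ⟨p • x, Quotient.sound ⟨p, by simp⟩⟩
  · intro q (x : X.carrier)
    refine Quotient.sound (s := tensorSetoid V X) ⟨f q, ?_⟩
    refine Prod.ext (hf q) ?_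
    exact (inv_smul_smul (f q) x).symm

/-- A biset which is free and transitive for the left action induces along a homomorphism. -/
theorem ofGSet_tensor_quot [Finite P] [Finite Q] (V : FinBiset Q P) (f : P →* Q) (b : V.carrier)
    (hb : Function.Bijective fun q : Q => q • b)
    (hf : ∀ p : P, MulOpposite.op p • b = f p • b) (X : Subgroup P) :
    ofGSet 𝔽 (V.tensor (FinGSet.quot X)) = ofGSet 𝔽 (FinGSet.quot (X.map f)) := by
  let w : (V.tensor (FinGSet.quot X)).carrier :=
    Quotient.mk (tensorSetoid V (FinGSet.quot X)) (b, ((1 : P) : P ⧸ X))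
  -- `q` fixes the class of `(b, X)` exactly when `q b = b p` for some `p ∈ X`, and `b p = f(p) b`;
  -- freeness then gives `q = f(p)`.
  have hstab : MulAction.stabilizer Q w = X.map f := by
    ext q
    rw [MulAction.mem_stabilizer_iff, Subgroup.mem_map]
    constructor
    · intro h
      obtain ⟨p, hp⟩ := Quotient.exact h.symm
      obtain ⟨h1, h2⟩ := Prod.mk.inj hp
      have h2' : ((1 : P) : P ⧸ X) = ((p⁻¹ * 1 : P) : P ⧸ X) := h2
      rw [QuotientGroup.eq] at h2'
      refine ⟨p, by simpa using h2', ?_⟩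
      exact (hb.1 (h1.trans (hf p))).symm
    · rintro ⟨p, hp, rfl⟩
      refine (Quotient.sound (s := tensorSetoid V (FinGSet.quot X)) ⟨p, Prod.ext (hf p).symm ?_⟩).symm
      change ((1 : P) : P ⧸ X) = ((p⁻¹ * 1 : P) : P ⧸ X)
      rw [QuotientGroup.eq]
      simpa using hp
  rw [ofGSet_eq_quot_stabilizer 𝔽 _ w, hstab]
  rintro ⟨v, x⟩
  obtain ⟨q, rfl⟩ := hb.2 v
  obtain ⟨p, rfl⟩ := QuotientGroup.mk_surjective x
  -- In the tensor product `[q b, pX] = [q b p, X] = [q f(p) b, X]`.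
  refine ⟨q * f p, ?_⟩
  refine Quotient.sound (s := tensorSetoid V (FinGSet.quot X)) ⟨p⁻¹, Prod.ext ?_ ?_⟩
  · change q • b = MulOpposite.op p⁻¹ • (q * f p) • b
    rw [← smul_comm, hf, smul_smul, mul_assoc, ← map_mul]
    simp
  · change ((p : P) : P ⧸ X) = ((p⁻¹⁻¹ * 1 : P) : P ⧸ X)
    simp

/-- `|Y| [P/Y]`. -/
noncomputable def cardQuot [Finite P] (Y : Subgroup P) : FBurnside 𝔽 P :=
  (Nat.card Y : 𝔽) • ofGSet 𝔽 (FinGSet.quot Y)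

theorem card_stabilizer_mul_card_orbit [Finite P] {A : Type*} [MulAction P A] (a : A) :
    Nat.card (MulAction.orbit P a) * Nat.card (MulAction.stabilizer P a) = Nat.card P := by
  rw [← Nat.card_prod, Nat.card_congr (MulAction.orbitProdStabilizerEquivGroup P a)]

/-- All stabilizers have order `|P|/|W|`, so the right side is `|W|` copies of `(|P|/|W|) [W]`. -/
theorem card_smul_ofGSet_of_transitive [Finite P] (W : FinGSet P) [Fintype W.carrier]
    (h : MulAction.IsPretransitive P W.carrier) :
    (Nat.card P : 𝔽) • ofGSet 𝔽 W = ∑ w : W.carrier, cardQuot 𝔽 (MulAction.stabilizer P w) := by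
  have key : ∀ w : W.carrier, cardQuot 𝔽 (MulAction.stabilizer P w) =
      (Nat.card (MulAction.stabilizer P w) : 𝔽) • ofGSet 𝔽 W := fun w => by
    rw [cardQuot, ← ofGSet_eq_quot_stabilizer 𝔽 W w (MulAction.exists_smul_eq P w)]
  rcases isEmpty_or_nonempty W.carrier with hW | ⟨⟨w₀⟩⟩
  · simp [ofGSet_eq_zero_of_isEmpty]
  · have hcard : ∀ w : W.carrier, Nat.card W.carrier *
        Nat.card (MulAction.stabilizer P w) = Nat.card P := fun w => by
      rw [← card_stabilizer_mul_card_orbit (P := P) w, MulAction.orbit_eq_univ,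
        Nat.card_coe_set_eq, Set.ncard_univ]
    have hpos : 0 < Nat.card W.carrier := Nat.card_pos_iff.2 ⟨⟨w₀⟩, inferInstance⟩
    have heq : ∀ w : W.carrier, Nat.card (MulAction.stabilizer P w) =
        Nat.card (MulAction.stabilizer P w₀) := fun w =>
      Nat.eq_of_mul_eq_mul_left hpos ((hcard w).trans (hcard w₀).symm)
    simp only [key, heq, Finset.sum_const, Finset.card_univ, ← Nat.card_eq_fintype_card]
    rw [← Nat.cast_smul_eq_nsmul 𝔽, smul_smul, ← hcard w₀, Nat.cast_mul]

/-- Orbit decomposition summed over points, which avoids choosing orbit representatives. Both sides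
are additive in `W`, so one orbit is split off at a time, by induction on `|W|`. -/
theorem card_smul_ofGSet [Finite P] (W : FinGSet P) [Fintype W.carrier] :
    (Nat.card P : 𝔽) • ofGSet 𝔽 W = ∑ w : W.carrier, cardQuot 𝔽 (MulAction.stabilizer P w) := by
  classical
  suffices H : ∀ (n : ℕ) (W : FinGSet P) [Fintype W.carrier], Nat.card W.carrier = n →
      (Nat.card P : 𝔽) • ofGSet 𝔽 W = ∑ w : W.carrier, cardQuot 𝔽 (MulAction.stabilizer P w) from
    H _ W rfl
  intro n
  induction n using Nat.strong_induction_on with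
  | _ n ih =>
    intro W _ hn
    rcases isEmpty_or_nonempty W.carrier with hW | ⟨⟨w⟩⟩
    · simp [ofGSet_eq_zero_of_isEmpty]
    · let s : Set W.carrier := MulAction.orbit P w
      have hs : ∀ (g : P), ∀ x ∈ s, g • x ∈ s := by
        rintro g _ ⟨h, rfl⟩
        exact ⟨g * h, mul_smul g h w⟩
      have hs' : ∀ (g : P), ∀ x ∈ sᶜ, g • x ∈ sᶜ := fun g x hx h =>
        hx (by simpa using hs g⁻¹ _ h)
      have stab : ∀ (t : Set W.carrier) (ht : ∀ (g : P), ∀ x ∈ t, g • x ∈ t)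
          (x : (W.sub t ht).carrier), MulAction.stabilizer P x =
            MulAction.stabilizer P (Subtype.val x : W.carrier) := by
        intro t ht x
        ext g
        exact Subtype.ext_iff
      let _ : Fintype (W.sub s hs).carrier := Subtype.fintype (· ∈ s)
      let _ : Fintype (W.sub sᶜ hs').carrier := Subtype.fintype (¬ · ∈ s)
      have h1 := card_smul_ofGSet_of_transitive 𝔽 (W.sub s hs) ⟨by
        rintro ⟨_, g, rfl⟩ ⟨_, h, rfl⟩
        refine ⟨h * g⁻¹, Subtype.ext ?_⟩
        change (h * g⁻¹) • g • w = h • w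
        simp [smul_smul]⟩
      have h2 := ih (Nat.card (W.sub sᶜ hs').carrier) (by
        rw [← hn]
        change Nat.card (sᶜ : Set W.carrier) < _
        refine Finite.card_subtype_lt (x := w) ?_
        exact fun h => h (MulAction.mem_orbit_self w)) (W.sub sᶜ hs') rfl
      rw [ofGSet_sub_add_compl 𝔽 W s hs hs', smul_add, h1, h2]
      simp only [stab]
      exact Fintype.sum_subtype_add_sum_subtype (· ∈ s)
        (fun w => cardQuot 𝔽 (MulAction.stabilizer P w))

/-- The quotients by both stabilizers are isomorphic to the orbit of `w`. -/
theorem cardQuot_stabilizer_smul [Finite P] (W : FinGSet P) (g : P) (w : W.carrier) :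
    cardQuot 𝔽 (MulAction.stabilizer P (g • w)) = cardQuot 𝔽 (MulAction.stabilizer P w) := by
  have hs : ∀ (h : P), ∀ x ∈ MulAction.orbit P w, h • x ∈ MulAction.orbit P w :=
    by
    rintro g _ ⟨h, rfl⟩
    exact ⟨g * h, mul_smul g h w⟩
  have key : ∀ x : W.carrier, ∀ hx : x ∈ MulAction.orbit P w,
      ofGSet 𝔽 (FinGSet.quot (MulAction.stabilizer P x)) =
      ofGSet 𝔽 (W.sub (MulAction.orbit P w) hs) := by
    intro x hx
    have : MulAction.stabilizer P x =
        MulAction.stabilizer P (⟨x, hx⟩ : (W.sub (MulAction.orbit P w) hs).carrier) := by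
      ext g
      exact (Subtype.ext_iff (a1 := (g • (⟨x, hx⟩ : (W.sub _ hs).carrier) :
        (W.sub _ hs).carrier)) (a2 := ⟨x, hx⟩)).symm
    rw [this]
    refine (ofGSet_eq_quot_stabilizer 𝔽 (W.sub _ hs) ⟨x, hx⟩ ?_).symm
    rintro ⟨y, hy⟩
    rw [← MulAction.orbit_eq_iff.2 hx] at hy
    obtain ⟨h, rfl⟩ := hy
    exact ⟨h, rfl⟩
  have hc : Nat.card (MulAction.stabilizer P (g • w)) = Nat.card (MulAction.stabilizer P w) :=
    Nat.card_congr (MulAction.stabilizerEquivStabilizerOfOrbitRel (G := P)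
      (MulAction.orbitRel_apply.2 (MulAction.mem_orbit w g))).toEquiv
  rw [cardQuot, cardQuot, hc, key _ (MulAction.mem_orbit w g), key _ (MulAction.mem_orbit_self w)]

/-- A Mackey formula: the point `(z, X)` has stabilizer `P_z ∩ X`, and each of the `|P/X|` cosets
contributes the same sum over `z`. -/
theorem card_smul_ofGSet_prod_quot [CharZero 𝔽] [Finite P] (Z : FinGSet P) [Fintype Z.carrier]
    (X : Subgroup P) :
    (Nat.card X : 𝔽) • ofGSet 𝔽 (Z.prod (FinGSet.quot X)) =
      ∑ z : Z.carrier, cardQuot 𝔽 (MulAction.stabilizer P z ⊓ X) := by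
  classical
  let _ : Fintype (P ⧸ X) := Fintype.ofFinite _
  let _ : Fintype (Z.prod (FinGSet.quot X)).carrier :=
    inferInstanceAs (Fintype (Z.carrier × (P ⧸ X)))
  have hstab : ∀ z : Z.carrier, MulAction.stabilizer P
      ((z, ((1 : P) : P ⧸ X)) : (Z.prod (FinGSet.quot X)).carrier) =
      MulAction.stabilizer P z ⊓ X := by
    intro z
    ext g
    change (g • z, ((g * 1 : P) : P ⧸ X)) = (z, ((1 : P) : P ⧸ X)) ↔ _
    rw [Prod.ext_iff, QuotientGroup.eq]
    simp
  have h := card_smul_ofGSet 𝔽 (Z.prod (FinGSet.quot X))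
  have hsum : ∑ w, cardQuot 𝔽 (MulAction.stabilizer P (w : (Z.prod (FinGSet.quot X)).carrier)) =
      (Nat.card (P ⧸ X) : 𝔽) • ∑ z : Z.carrier, cardQuot 𝔽 (MulAction.stabilizer P z ⊓ X) := by
    refine (Fintype.sum_prod_type_right (α₁ := Z.carrier) (α₂ := P ⧸ X) _).trans ?_
    rw [Nat.card_eq_fintype_card, Nat.cast_smul_eq_nsmul, ← Finset.card_univ,
      ← Finset.sum_const]
    refine Finset.sum_congr rfl fun c _ => ?_
    obtain ⟨a, rfl⟩ := QuotientGroup.mk_surjective c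
    -- Replacing `z` by `a z` turns the point `(z, aX)` into `a • (z, X)`, whose term equals that of
    -- `(z, X)`.
    rw [← Equiv.sum_comp (MulAction.toPerm a : Equiv.Perm Z.carrier)]
    refine Finset.sum_congr rfl fun z _ => ?_
    rw [← hstab]
    have hz : a • ((z, ((1 : P) : P ⧸ X)) : (Z.prod (FinGSet.quot X)).carrier) =
        (a • z, ((a : P) : P ⧸ X)) :=
      Prod.ext rfl (congrArg (QuotientGroup.mk : P → P ⧸ X) (mul_one a))
    exact (congrArg (fun w : (Z.prod (FinGSet.quot X)).carrier =>
      cardQuot 𝔽 (MulAction.stabilizer P w)) hz.symm).trans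
      (cardQuot_stabilizer_smul 𝔽 (Z.prod (FinGSet.quot X)) a (z, ((1 : P) : P ⧸ X)))
  rw [hsum, Subgroup.card_eq_card_quotient_mul_card_subgroup X, Nat.cast_mul, mul_smul] at h
  -- The common factor `|P/X|` is invertible in characteristic `0`.
  exact (smul_right_injective _ (Nat.cast_ne_zero.2 Nat.card_pos.ne')) h

end GSets

/-! ### The Möbius function of the subgroup poset. -/

section Moebius

variable {P Q : Type u} [Group P] [Group Q] [Finite P] [Finite Q]

theorem subgroupMu_self (S : Subgroup P) : subgroupMu S S = 1 := by
  simp [subgroupMu]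

open Classical in
theorem sum_subgroupMu [Fintype (Subgroup P)] (Y S : Subgroup P) :
    ∑ X : Subgroup P with Y ≤ X ∧ X ≤ S, subgroupMu X S = if Y = S then 1 else 0 := by
  let _ : LocallyFiniteOrder (Subgroup P) := Fintype.toLocallyFiniteOrder
  rw [← IncidenceAlgebra.sum_Icc_mu_left (𝕜 := ℤ) (α := Subgroup P) Y S]
  refine Finset.sum_congr (by ext; simp) fun X _ => ?_
  -- `subgroupMu` makes its own choice of order instances; they are subsingletons, so `congr!`
  -- identifies them with the present ones.
  unfold subgroupMu
  congr!

open Classical in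
/-- **Weisner's theorem**, in summed form. -/
theorem sum_subgroupMu_smul_inf [Fintype (Subgroup P)] {M : Type*} [AddCommGroup M]
    (F : Subgroup P → M) {S T : Subgroup P} (hT : ¬ S ≤ T) :
    ∑ X : Subgroup P with X ≤ S, subgroupMu X S • F (T ⊓ X) = 0 := by
  -- Every fibre of `X ↦ T ⊓ X` has zero Möbius sum. By downward induction on `Y`: the fibre sums
  -- over all `Z ≥ Y` add up to the sum of `μ(X,S)` over `Y ≤ X ≤ S`, which is `0` since `Y ≤ T`
  -- forces `Y ≠ S`; those with `Z > Y` already vanish.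
  have hf : ∀ Y : Subgroup P,
      ∑ X : Subgroup P with X ≤ S ∧ T ⊓ X = Y, subgroupMu X S = 0 := by
    intro Y
    induction Y using WellFoundedGT.induction with
    | _ Y ih =>
      by_cases hY : Y ≤ T ∧ Y ≤ S
      · have h := sum_subgroupMu Y S
        rw [if_neg (by rintro rfl; exact hT hY.1)] at h
        have hfib := Finset.sum_fiberwise
          ({X : Subgroup P | Y ≤ X ∧ X ≤ S} : Finset _) (fun X => T ⊓ X) (subgroupMu · S)
        rw [h, Finset.sum_eq_single Y] at hfib
        · rw [← hfib]
          refine Finset.sum_congr ?_ fun _ _ => rfl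
          ext X
          simp only [Finset.mem_filter, Finset.mem_univ, true_and]
          constructor
          · rintro ⟨h1, rfl⟩
            exact ⟨⟨inf_le_right, h1⟩, rfl⟩
          · rintro ⟨⟨_, h1⟩, h2⟩
            exact ⟨h1, h2⟩
        · intro Z _ hZ
          by_cases hYZ : Y ≤ Z
          · rw [← ih Z (lt_of_le_of_ne hYZ hZ.symm)]
            refine Finset.sum_congr ?_ fun _ _ => rfl
            ext X
            simp only [Finset.mem_filter, Finset.mem_univ, true_and]
            constructor
            · rintro ⟨⟨_, h1⟩, h2⟩
              exact ⟨h1, h2⟩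
            · rintro ⟨h1, rfl⟩
              exact ⟨⟨hYZ.trans inf_le_right, h1⟩, rfl⟩
          · refine Finset.sum_eq_zero fun X hX => ?_
            simp only [Finset.mem_filter, Finset.mem_univ, true_and] at hX
            exact absurd (hX.2 ▸ le_inf hY.1 hX.1.1) hYZ
        · simp
      · refine Finset.sum_eq_zero fun X hX => ?_
        simp only [Finset.mem_filter, Finset.mem_univ, true_and] at hX
        exact absurd ⟨hX.2 ▸ inf_le_left, hX.2 ▸ inf_le_right.trans hX.1⟩ hY
  rw [← Finset.sum_fiberwise _ (fun X => T ⊓ X)]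
  refine Finset.sum_eq_zero fun Y _ => ?_
  have : ∀ X ∈ (({X : Subgroup P | X ≤ S} : Finset _).filter fun X => T ⊓ X = Y),
      subgroupMu X S • F (T ⊓ X) = subgroupMu X S • F Y := fun X hX => by
    rw [(Finset.mem_filter.1 hX).2]
  rw [Finset.sum_congr rfl this, ← Finset.sum_smul, Finset.filter_filter, hf, zero_smul]

/-- A homomorphism which is injective on `S` identifies the subgroups of `S` with those of its
image. -/
def mapIicEquiv (f : P →* Q) (S : Subgroup P) (hf : Set.InjOn f S) :
    {X : Subgroup P // X ≤ S} ≃o {Y : Subgroup Q // Y ≤ S.map f} where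
  toFun X := ⟨X.1.map f, Subgroup.map_mono X.2⟩
  invFun Y := ⟨Y.1.comap f ⊓ S, inf_le_right⟩
  left_inv := by
    rintro ⟨X, hX⟩
    refine Subtype.ext (Subgroup.ext fun x => ⟨?_, fun hx => ⟨⟨x, hx, rfl⟩, hX hx⟩⟩)
    rintro ⟨⟨y, hy, hyx⟩, hx⟩
    exact hf (hX hy) hx hyx ▸ hy
  right_inv := by
    rintro ⟨Y, hY⟩
    refine Subtype.ext (Subgroup.ext fun y => ⟨?_, fun hy => ?_⟩)
    · rintro ⟨x, hx, rfl⟩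
      exact hx.1
    · obtain ⟨x, hx, rfl⟩ := hY hy
      exact ⟨x, ⟨hy, hx⟩, rfl⟩
  map_rel_iff' := by
    rintro ⟨X, hX⟩ ⟨X', hX'⟩
    refine ⟨fun h x hx => ?_, fun h => Subgroup.map_mono h⟩
    obtain ⟨y, hy, hyx⟩ := h ⟨x, hx, rfl⟩
    exact hf (hX' hy) (hX hx) hyx ▸ hy

open Classical in
theorem subgroupMu_eq_neg_sum [Fintype (Subgroup P)] {X S : Subgroup P} (h : X ≠ S) :
    subgroupMu X S = -∑ Y : Subgroup P with X < Y ∧ Y ≤ S, subgroupMu Y S := by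
  let _ : LocallyFiniteOrder (Subgroup P) := Fintype.toLocallyFiniteOrder
  have hmu : ∀ Y : Subgroup P, subgroupMu Y S = IncidenceAlgebra.mu ℤ Y S := fun Y => by
    unfold subgroupMu
    congr!
  simp only [hmu]
  rw [IncidenceAlgebra.mu_eq_neg_sum_Ioc_of_ne h]
  exact congrArg _ (Finset.sum_congr (by ext; simp) fun _ _ => rfl)

/-- The value `μ(X,S)` depends only on the interval from `X` to `S`, which `f` carries
isomorphically to its image; the recursion for `μ` turns this into a downward induction on `X`. -/
theorem subgroupMu_map (f : P →* Q) {S : Subgroup P} (hf : Set.InjOn f S) (X : Subgroup P)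
    (hX : X ≤ S) : subgroupMu (X.map f) (S.map f) = subgroupMu X S := by
  classical
  let _ : Fintype (Subgroup P) := Fintype.ofFinite _
  let _ : Fintype (Subgroup Q) := Fintype.ofFinite _
  let e := mapIicEquiv f S hf
  induction X using WellFoundedGT.induction with
  | _ X ih =>
    by_cases h : X = S
    · rw [h, subgroupMu_self, subgroupMu_self]
    · have h' : X.map f ≠ S.map f := fun h' => h (congrArg Subtype.val
        (e.injective (a₁ := ⟨X, hX⟩) (a₂ := ⟨S, le_rfl⟩) (Subtype.ext h')))
      rw [subgroupMu_eq_neg_sum h, subgroupMu_eq_neg_sum h']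
      congr 1
      symm
      refine Finset.sum_bij (fun Y _ => Y.map f) ?_ ?_ ?_ ?_
      · intro Y hY
        simp only [Finset.mem_filter, Finset.mem_univ, true_and] at hY ⊢
        exact ⟨e.lt_iff_lt (x := ⟨X, hX⟩) (y := ⟨Y, hY.2⟩) |>.2 hY.1, Subgroup.map_mono hY.2⟩
      · intro Y hY Y' hY' hYY'
        simp only [Finset.mem_filter, Finset.mem_univ, true_and] at hY hY'
        exact congrArg Subtype.val
          (e.injective (a₁ := ⟨Y, hY.2⟩) (a₂ := ⟨Y', hY'.2⟩) (Subtype.ext hYY'))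
      · intro Z hZ
        simp only [Finset.mem_filter, Finset.mem_univ, true_and] at hZ
        obtain ⟨⟨Y, hY⟩, hYZ⟩ := e.surjective ⟨Z, hZ.2⟩
        obtain rfl : Y.map f = Z := congrArg Subtype.val hYZ
        refine ⟨Y, ?_, rfl⟩
        simp only [Finset.mem_filter, Finset.mem_univ, true_and]
        exact ⟨e.lt_iff_lt (x := ⟨X, hX⟩) (y := ⟨Y, hY⟩) |>.1 hZ.1, hY⟩
      · intro Y hY
        simp only [Finset.mem_filter, Finset.mem_univ, true_and] at hY
        exact (ih Y hY.1 hY.2).symm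

end Moebius

/-! ### Images of idempotents, and multiplication by the class of a set. -/

section Idempotents

variable (𝔽 : Type v) [Field 𝔽] {P Q : Type u} [Group P] [Group Q] [Finite P] [Finite Q]

open Classical in
theorem idem_eq_sum [Fintype (Subgroup P)] (S : Subgroup P) :
    idem 𝔽 S = (Nat.card (Subgroup.normalizer (S : Set P)) : 𝔽)⁻¹ •
      ∑ X : Subgroup P with X ≤ S, subgroupMu X S • cardQuot 𝔽 X := by
  rw [idem, finsum_eq_sum_of_fintype]
  congr 1
  rw [← Finset.sum_subtype_eq_sum_filter]
  refine Finset.sum_congr (by ext; simp) fun X _ => ?_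
  rw [cardQuot, mul_comm, mul_smul, Int.cast_smul_eq_zsmul]

/-- A linear map taking `[P/X]` to `[Q/f(X)]` takes idempotents of subgroups on which `f` is
injective to multiples of idempotents. -/
theorem map_idem [CharZero 𝔽] (f : P →* Q) (T : FBurnside 𝔽 P →ₗ[𝔽] FBurnside 𝔽 Q)
    (hT : ∀ X : Subgroup P,
      T (ofGSet 𝔽 (FinGSet.quot X)) = ofGSet 𝔽 (FinGSet.quot (X.map f)))
    {S : Subgroup P} (hf : Set.InjOn f S) :
    idem 𝔽 (S.map f) =
      ((Nat.card (Subgroup.normalizer (S.map f : Set Q)) : 𝔽)⁻¹ *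
        (Nat.card (Subgroup.normalizer (S : Set P)) : 𝔽)) • T (idem 𝔽 S) := by
  classical
  let _ : Fintype (Subgroup P) := Fintype.ofFinite _
  let _ : Fintype (Subgroup Q) := Fintype.ofFinite _
  have hN : (Nat.card (Subgroup.normalizer (S : Set P)) : 𝔽) ≠ 0 :=
    Nat.cast_ne_zero.2 Nat.card_pos.ne'
  -- Only the orders of the normalizers can differ, whence the scalar; the remaining sums match term
  -- by term.
  rw [idem_eq_sum, idem_eq_sum, map_smul, smul_smul, mul_assoc, mul_inv_cancel₀ hN, mul_one]
  congr 1
  let e := mapIicEquiv f S hf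
  rw [map_sum]
  symm
  refine Finset.sum_bij (fun Y _ => Y.map f) ?_ ?_ ?_ ?_
  · intro Y hY
    simp only [Finset.mem_filter, Finset.mem_univ, true_and] at hY ⊢
    exact Subgroup.map_mono hY
  · intro Y hY Y' hY' hYY'
    simp only [Finset.mem_filter, Finset.mem_univ, true_and] at hY hY'
    exact congrArg Subtype.val
      (e.injective (a₁ := ⟨Y, hY⟩) (a₂ := ⟨Y', hY'⟩) (Subtype.ext hYY'))
  · intro Z hZ
    simp only [Finset.mem_filter, Finset.mem_univ, true_and] at hZ
    obtain ⟨⟨Y, hY⟩, hYZ⟩ := e.surjective ⟨Z, hZ⟩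
    exact ⟨Y, by simpa using hY, congrArg Subtype.val hYZ⟩
  · intro Y hY
    simp only [Finset.mem_filter, Finset.mem_univ, true_and] at hY
    have hcard : Nat.card (Y.map f) = Nat.card Y :=
      Nat.card_image_of_injOn (hf.mono hY)
    rw [subgroupMu_map f hf Y hY, map_zsmul, cardQuot, cardQuot, map_smul, hT, hcard]

/-- Multiplication by `[Z]` acts on the idempotent of `S` as the number of `S`-fixed points. -/
theorem mul_idem [CharZero 𝔽] (Z : FinGSet P) (T : FBurnside 𝔽 P →ₗ[𝔽] FBurnside 𝔽 P)
    (hT : ∀ X : FinGSet P, T (ofGSet 𝔽 X) = ofGSet 𝔽 (Z.prod X)) (S : Subgroup P) :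
    T (idem 𝔽 S) = (Nat.card {z : Z.carrier // S ≤ MulAction.stabilizer P z} : 𝔽) •
      idem 𝔽 S := by
  classical
  let _ : Fintype (Subgroup P) := Fintype.ofFinite _
  let _ : Fintype Z.carrier := Fintype.ofFinite _
  rw [idem_eq_sum, map_smul, smul_comm]
  congr 1
  have h1 : ∀ X : Subgroup P, T (cardQuot 𝔽 X) =
      ∑ z : Z.carrier, cardQuot 𝔽 (MulAction.stabilizer P z ⊓ X) := fun X => by
    rw [cardQuot, map_smul, hT, card_smul_ofGSet_prod_quot]
  simp only [map_sum, map_zsmul, h1, Finset.smul_sum]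
  rw [Finset.sum_comm]
  -- If `S` fixes `z`, then `P_z ∩ X = X` for all `X ≤ S`; otherwise Weisner's theorem kills the
  -- sum. Hence the count of fixed points.
  have h2 : ∀ z : Z.carrier, ∑ X : Subgroup P with X ≤ S,
      subgroupMu X S • cardQuot 𝔽 (MulAction.stabilizer P z ⊓ X) =
      if S ≤ MulAction.stabilizer P z then
        ∑ X : Subgroup P with X ≤ S, subgroupMu X S • cardQuot 𝔽 X else 0 := by
    intro z
    split_ifs with hz
    · refine Finset.sum_congr rfl fun X hX => ?_
      rw [inf_eq_right.2 ((Finset.mem_filter.1 hX).2.trans hz)]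
    · exact sum_subgroupMu_smul_inf _ hz
  simp only [h2]
  rw [← Finset.sum_filter, Finset.sum_const, Nat.card_eq_fintype_card, Fintype.card_subtype,
    ← Nat.cast_smul_eq_nsmul 𝔽, Finset.smul_sum]

end Idempotents

theorem map_graph_sndProj {G K : Type u} [Group G] [Group K] (L : Subgroup (G × K)) :
    (sndProj L).graph.map
      (((MonoidHom.fst G K).comp L.subtype).prodMap (MonoidHom.id K)) = L := by
  ext x
  constructor
  · rintro ⟨⟨l, k⟩, h, rfl⟩
    obtain rfl : sndProj L l = k := h
    exact l.2
  · exact fun hx => ⟨(⟨x, hx⟩, x.2), rfl, rfl⟩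

theorem injOn_graph_sndProj {G K : Type u} [Group G] [Group K] (L : Subgroup (G × K)) :
    Set.InjOn (((MonoidHom.fst G K).comp L.subtype).prodMap (MonoidHom.id K))
      ((sndProj L).graph : Set (L × K)) := by
  rintro ⟨l, k⟩ h ⟨l', k'⟩ h' hll'
  obtain rfl : sndProj L l = k := h
  obtain rfl : sndProj L l' = k' := h'
  obtain rfl : l = l' := Subtype.ext hll'
  rfl

/-! ### Restriction, induction and internal product in the shifted functor; transfer of idempotents.
-/

section Shifted

variable (𝔽 : Type v) [Field 𝔽] (K : Type u) [Group K] [Finite K]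
  {G H : Type u} [Group G] [Group H] [Finite G]

theorem shiftedMap_ofHom (f : H →* G) (X : FinGSet (G × K)) :
    shiftedMap 𝔽 K (FinBiset.ofHom f) (ofGSet 𝔽 X) =
      ofGSet 𝔽 (X.res (f.prodMap (MonoidHom.id K))) := by
  rw [shiftedMap, burnsideMap_ofGSet]
  -- The shifted biset is `G × K` with its regular right action, so the identity serves as base
  -- point.
  refine ofGSet_tensor_eq_res 𝔽 _ _ ((1, 1) : G × K) ⟨?_, ?_⟩ ?_ X
  · intro p q h
    have h' : ((1 * p.1, 1 * p.2) : G × K) = (1 * q.1, 1 * q.2) := h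
    simpa [Prod.ext_iff] using h'
  · intro p
    exact ⟨p, Prod.ext (one_mul (M := G) p.1) (one_mul (M := K) p.2)⟩
  · intro q
    exact Prod.ext ((mul_one (f q.1)).trans (one_mul (f q.1)).symm)
      ((mul_one q.2).trans (one_mul q.2).symm)

/-- The `(H,G)`-biset `H` attached to a homomorphism `f : G → H`, with `h·x·g = h x f(g)`. -/
def FinBiset.ofHomOp [Finite H] (f : G →* H) : FinBiset H G where
  carrier := H
  left := inferInstance
  right := MulAction.compHom H (MonoidHom.op f)
  comm :=
    letI := MulAction.compHom H (MonoidHom.op f)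
    ⟨fun h g x => (mul_assoc h x (f g.unop)).symm⟩

theorem shiftedMap_ofHomOp_quot [Finite H] (f : G →* H) (X : Subgroup (G × K)) :
    shiftedMap 𝔽 K (FinBiset.ofHomOp f) (ofGSet 𝔽 (FinGSet.quot X)) =
      ofGSet 𝔽 (FinGSet.quot (X.map (f.prodMap (MonoidHom.id K)))) := by
  rw [shiftedMap, burnsideMap_ofGSet]
  refine ofGSet_tensor_quot 𝔽 _ _ ((1, 1) : H × K) ⟨?_, ?_⟩ ?_ X
  · intro p q h
    have h' : ((p.1 * 1, p.2 * 1) : H × K) = (q.1 * 1, q.2 * 1) := h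
    simpa [Prod.ext_iff] using h'
  · intro p
    exact ⟨p, Prod.ext (mul_one (M := H) p.1) (mul_one (M := K) p.2)⟩
  · intro q
    exact Prod.ext ((one_mul (f q.1)).trans (mul_one (f q.1)).symm)
      ((one_mul q.2).trans (mul_one q.2).symm)

/-- The multiplication of `𝔽B_K(G)`: the product in `𝔽B_K(G × G)`, restricted to the diagonal. -/
noncomputable def diagMul : FBK 𝔽 K G →ₗ[𝔽] FBK 𝔽 K G →ₗ[𝔽] FBK 𝔽 K G :=
  (fburnsideProd 𝔽).compr₂
    (shiftedMap 𝔽 K (FinBiset.ofHom ((MonoidHom.id G).prod (MonoidHom.id G))) ∘ₗ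
      burnsideMap 𝔽 (FinBiset.ofHom (shiftDiag G G K)))

/-- `diagMul` is a shifted product followed by a biset map, and ideals are stable under both. -/
theorem diagMul_mem (I : ShiftedIdeal 𝔽 K) (a b : FBK 𝔽 K G) (hb : b ∈ I.obj G) :
    diagMul 𝔽 K a b ∈ I.obj G :=
  I.map_mem _ _ (I.prod_mem a b hb)

theorem burnsideMap_ofHom (f : H →* G) (X : FinGSet G) :
    burnsideMap 𝔽 (FinBiset.ofHom f) (ofGSet 𝔽 X) = ofGSet 𝔽 (X.res f) := by
  rw [burnsideMap_ofGSet]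
  refine ofGSet_tensor_eq_res 𝔽 _ _ (1 : G) ⟨?_, ?_⟩ ?_ X
  · intro p q h
    have h' : (1 * p : G) = 1 * q := h
    simpa using h'
  · intro p
    exact ⟨p, one_mul (M := G) p⟩
  · intro q
    exact (mul_one (f q)).trans (one_mul (f q)).symm

/-- The composite `(g,k) ↦ ((g,g),k) ↦ ((g,k),(g,k))` is the diagonal of `G × K`. -/
theorem diagMul_ofGSet (X Y : FinGSet (G × K)) :
    diagMul 𝔽 K (ofGSet 𝔽 X) (ofGSet 𝔽 Y) = ofGSet 𝔽 (X.prod Y) := by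
  rw [diagMul, LinearMap.compr₂_apply, LinearMap.comp_apply]
  rw [fburnsideProd_ofGSet, burnsideMap_ofHom, shiftedMap_ofHom]
  exact ofGSet_eq_of_isIso 𝔽 ⟨Equiv.refl _, fun _ _ => rfl⟩

/-- If `f × id` maps `S` onto `L`, restricting `e_L` along `f` and multiplying by `e_S` gives a
nonzero multiple of `e_S`. -/
theorem diagMul_idem_res_idem [CharZero 𝔽] [Finite H] (f : H →* G) (S : Subgroup (H × K)) :
    ∃ c : 𝔽, c ≠ 0 ∧ diagMul 𝔽 K (idem 𝔽 S) (shiftedMap 𝔽 K (FinBiset.ofHom f)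
      (idem 𝔽 (S.map (f.prodMap (MonoidHom.id K))))) = c • idem 𝔽 S := by
  classical
  let _ : Fintype (Subgroup (G × K)) := Fintype.ofFinite _
  set F := f.prodMap (MonoidHom.id K)
  set L := S.map F with hL
  have hT : ∀ X : Subgroup (G × K), diagMul 𝔽 K (idem 𝔽 S) (shiftedMap 𝔽 K (FinBiset.ofHom f)
      (ofGSet 𝔽 (FinGSet.quot X))) =
      (Nat.card {z : ((FinGSet.quot X).res F).carrier // S ≤ MulAction.stabilizer (H × K) z} : 𝔽) •
        idem 𝔽 S := by
    intro X
    rw [shiftedMap_ofHom]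
    refine mul_idem 𝔽 ((FinGSet.quot X).res F) ((diagMul 𝔽 K).flip _) (fun Y => ?_) S
    rw [LinearMap.flip_apply, diagMul_ofGSet]
    exact ofGSet_eq_of_isIso 𝔽 ⟨Equiv.prodComm _ _, fun _ _ => rfl⟩
  have hempty : ∀ X : Subgroup (G × K), X ≤ L → X ≠ L →
      IsEmpty {z : ((FinGSet.quot X).res F).carrier // S ≤ MulAction.stabilizer (H × K) z} := by
    refine fun X hX hne => ⟨?_⟩
    rintro ⟨z, hz⟩
    obtain ⟨q, rfl⟩ := QuotientGroup.mk_surjective z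
    -- A coset `qX` fixed by `S`, which acts through `F(S) = L`, gives `q⁻¹Lq ≤ X`; comparing orders
    -- with `X ≤ L` yields `X = L`.
    have hsub : L.map (MulAut.conj q⁻¹).toMonoidHom ≤ X := by
      rintro _ ⟨_, ⟨s, hs, rfl⟩, rfl⟩
      have h : ((F s * q : G × K) : (G × K) ⧸ X) = (q : (G × K) ⧸ X) := hz hs
      rw [eq_comm, QuotientGroup.eq] at h
      simpa [mul_assoc] using h
    refine hne (Subgroup.eq_of_le_of_card_ge hX ?_)
    rw [← Subgroup.card_map_of_injective (K := L) (f := (MulAut.conj q⁻¹).toMonoidHom)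
      (MulAut.conj q⁻¹).injective]
    exact Subgroup.card_le_of_le hsub
  have hne : Nonempty
      {z : ((FinGSet.quot L).res F).carrier // S ≤ MulAction.stabilizer (H × K) z} := by
    refine ⟨⟨((1 : G × K) : (G × K) ⧸ L), fun s hs => ?_⟩⟩
    change ((F s * 1 : G × K) : (G × K) ⧸ L) = ((1 : G × K) : (G × K) ⧸ L)
    rw [eq_comm, QuotientGroup.eq, inv_one, one_mul, mul_one]
    exact Subgroup.mem_map_of_mem F hs
  have : Finite ((FinGSet.quot L).res F).carrier := ((FinGSet.quot L).res F).finite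
  -- This is the contribution of `X = L`, the only surviving term, with `μ(L,L) = 1`. The trivial
  -- coset is fixed, so the last factor is nonzero.
  refine ⟨(Nat.card (Subgroup.normalizer (L : Set (G × K))) : 𝔽)⁻¹ * ((Nat.card L : 𝔽) *
    (Nat.card {z : ((FinGSet.quot L).res F).carrier //
      S ≤ MulAction.stabilizer (H × K) z} : 𝔽)), ?_, ?_⟩
  · exact mul_ne_zero (inv_ne_zero (Nat.cast_ne_zero.2 Nat.card_pos.ne'))
      (mul_ne_zero (Nat.cast_ne_zero.2 Nat.card_pos.ne') (Nat.cast_ne_zero.2 Nat.card_pos.ne'))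
  · rw [idem_eq_sum 𝔽 L]
    simp only [map_smul, map_sum, map_zsmul, cardQuot, hT]
    rw [Finset.sum_eq_single L, subgroupMu_self, one_smul, smul_smul, smul_smul, mul_assoc]
    · intro X hX hXL
      have := hempty X (Finset.mem_filter.1 hX).2 hXL
      simp
    · simp

theorem idem_mem_iff [CharZero 𝔽] (L : Subgroup (G × K)) (I : ShiftedIdeal 𝔽 K) :
    idem 𝔽 L ∈ I.obj G ↔ idem 𝔽 (sndProj L).graph ∈ I.obj L := by
  constructor
  · intro h
    obtain ⟨c, hc, hcL⟩ := diagMul_idem_res_idem 𝔽 K ((MonoidHom.fst G K).comp L.subtype)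
      (sndProj L).graph
    rw [map_graph_sndProj] at hcL
    have hmem := diagMul_mem 𝔽 K I (idem 𝔽 (sndProj L).graph) _
      (I.map_mem (FinBiset.ofHom ((MonoidHom.fst G K).comp L.subtype)) _ h)
    rw [hcL] at hmem
    exact (Submodule.smul_mem_iff _ hc).1 hmem
  · intro h
    -- Induction along `p₁`, which exhibits `e_L` as a multiple of the image of the graph
    -- idempotent.
    have hL := map_idem 𝔽 (((MonoidHom.fst G K).comp L.subtype).prodMap (MonoidHom.id K))
      (shiftedMap 𝔽 K (FinBiset.ofHomOp ((MonoidHom.fst G K).comp L.subtype)))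
      (shiftedMap_ofHomOp_quot 𝔽 K _) (injOn_graph_sndProj L)
    rw [map_graph_sndProj] at hL
    rw [hL]
    exact Submodule.smul_mem _ _ (I.map_mem _ _ h)

theorem ShiftedIdeal.ext_obj {I J : ShiftedIdeal 𝔽 K}
    (h : ∀ (G : Type u) [Group G] [Finite G], I.obj G = J.obj G) : I = J := by
  obtain ⟨I, _, _⟩ := I
  obtain ⟨J, _, _⟩ := J
  obtain rfl : @I = @J := by
    funext G _ _
    exact h G
  rfl

/-- Both spans are intersections over the same collection of ideals. -/
theorem ShiftedIdeal.span_eq_span [Finite H] {a : FBK 𝔽 K G} {b : FBK 𝔽 K H}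
    (h : ∀ I : ShiftedIdeal 𝔽 K, a ∈ I.obj G ↔ b ∈ I.obj H) :
    ShiftedIdeal.span 𝔽 K G a = ShiftedIdeal.span 𝔽 K H b := by
  refine ShiftedIdeal.ext_obj 𝔽 K fun J _ _ => ?_
  simp only [ShiftedIdeal.span, iInf_subtype, h]

end Shifted

end BurnsideShift

theorem mainTheorem7 {𝔽 : Type v} [Field 𝔽] [CharZero 𝔽] {K : Type u} [Group K] [Finite K]
    {G : Type u} [Group G] [Finite G] (L : Subgroup (G × K)) :
    (∀ I : BurnsideShift.ShiftedIdeal 𝔽 K,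
      BurnsideShift.idem 𝔽 L ∈ I.obj G ↔
        BurnsideShift.idem 𝔽 (BurnsideShift.sndProj L).graph ∈ I.obj L) ∧
    BurnsideShift.ShiftedIdeal.span 𝔽 K G (BurnsideShift.idem 𝔽 L) =
      BurnsideShift.groupOverIdeal 𝔽 L (BurnsideShift.sndProj L) :=
  ⟨BurnsideShift.idem_mem_iff 𝔽 K L,
    BurnsideShift.ShiftedIdeal.span_eq_span 𝔽 K (BurnsideShift.idem_mem_iff 𝔽 K L)⟩
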